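/- Let $G$ be a discrete group, $A$ a C*-algebra (not necessarily unital), $\alpha:G\to\mathrm{Aut}(A)$ an action by *-automorphisms, and $A^\alpha=\{a\in A:\alpha_t(a)=a \text{ for all } t\in G\}$ its fixed point algebra. Let $(\pi,u,H)$ be a covariant representation of $(G,A,\alpha)$: $H$ is a complex Hilbert space, $\pi:A\to B(H)$ is a *-representation and $u:G\to U(H)$ is a unitary representation with $u_t\pi(a)u_t^*=\pi(\alpha_t(a))$ for all $t\in G$, $a\in A$. Let $G$ act on $B(H)$ by $\mathrm{Ad}_{u_t}(x)=u_txu_t^*$. Let $\mathfrak M$ be the set of all unital completely positive, $G$-equivariant maps $\phi:B(H)\to B(H)$ with $\phi|_{\pi(A^\alpha)}=\mathrm{id}$, preordered by $\psi\le\phi$ iff $\|\psi(x)\|\le\|\phi(x)\|$ for all $x\in B(H)$. An element $\phi\in\mathfrak M$ is minimal if every $\psi\in\mathfrak M$ with $\psi\le\phi$ also satisfies $\phi\le\psi$. The Furstenberg–Hamana boundary of $(\pi,u,H)$ is the $G$-invariant subspace $\mathcal B_{\pi,u}=\mathrm{Im}(\phi)\subseteq B(H)$, where $\phi$ is a minimal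 element of $\mathfrak M$, with the restricted action of $G$ by $\mathrm{Ad}_u$. Then, for every covariant representation $(\pi,u,H)$ and every choice of the minimal element $\phi$, every element $g\in G$ whose conjugacy class $\{hgh^{-1}:h\in G\}$ is finite acts trivially on $\mathcal B_{\pi,u}$, that is, $u_gxu_g^*=x$ for all $x\in\mathcal B_{\pi,u}$. -/

import Mathlib

open scoped CStarAlgebra

noncomputable section

/-- The fixed point algebra `A^α = {a ∈ A : α_t(a) = a for all t ∈ G}` of an action `α` of the
(discrete) group `G` on the, not necessarily unital, C*-algebra `A` by *-automorphisms. -/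
def fixedPointAlgebra {G A : Type*} [Group G] [NonUnitalCStarAlgebra A]
    (α : G →* (A ≃⋆ₐ[ℂ] A)) : NonUnitalStarSubalgebra ℂ A where
  carrier := {a | ∀ t : G, α t a = a}
  add_mem' ha hb t := by rw [map_add, ha t, hb t]
  zero_mem' t := map_zero (α t)
  mul_mem' ha hb t := by rw [map_mul, ha t, hb t]
  smul_mem' c a ha t := by rw [map_smul, ha t]
  star_mem' ha t := by rw [map_star, ha t]

/-- A covariant representation `(π, u, H)` of the C*-dynamical system `(G, A, α)`: a
*-representation `π` of `A` and a unitary representation `u` of `G` on the same Hilbert space `H`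
such that `u_t π(a) u_t* = π(α_t(a))`. -/
structure CovariantRep {G A : Type*} [Group G] [NonUnitalCStarAlgebra A]
    (α : G →* (A ≃⋆ₐ[ℂ] A))
    (H : Type*) [NormedAddCommGroup H] [InnerProductSpace ℂ H] [CompleteSpace H] where
  π : A →⋆ₙₐ[ℂ] (H →L[ℂ] H)
  u : G →* unitary (H →L[ℂ] H)
  covariant : ∀ (t : G) (a : A),
    (u t : H →L[ℂ] H) * π a * star (u t : H →L[ℂ] H) = π (α t a)

namespace CovariantRep

variable {G A : Type*} [Group G] [NonUnitalCStarAlgebra A] {α : G →* (A ≃⋆ₐ[ℂ] A)}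
  {H : Type*} [NormedAddCommGroup H] [InnerProductSpace ℂ H] [CompleteSpace H]

/-- The adjoint action `Ad_{u_t} : x ↦ u_t x u_t*` of `G` on `B(H)` by *-automorphisms. -/
def Ad (R : CovariantRep α H) : G →* ((H →L[ℂ] H) ≃⋆ₐ[ℂ] (H →L[ℂ] H)) :=
  (Unitary.conjStarAlgAut ℂ (H →L[ℂ] H)).comp R.u

theorem Ad_apply (R : CovariantRep α H) (t : G) (x : H →L[ℂ] H) :
    R.Ad t x = (R.u t : H →L[ℂ] H) * x * star (R.u t : H →L[ℂ] H) := rfl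

/-- A `G`-map `B(H) → B(H)`: a unital completely positive map which is equivariant for the
adjoint action. -/
structure IsGMap (R : CovariantRep α H) (φ : (H →L[ℂ] H) →CP (H →L[ℂ] H)) : Prop where
  unital : φ 1 = 1
  equivariant : ∀ (t : G) (x : H →L[ℂ] H), φ (R.Ad t x) = R.Ad t (φ x)

/-- The set `𝔐` of all `G`-maps `B(H) → B(H)` that restrict to the identity on `π(A^α)`. -/
def gMaps (R : CovariantRep α H) : Set ((H →L[ℂ] H) →CP (H →L[ℂ] H)) :=
  {φ | R.IsGMap φ ∧ ∀ a ∈ fixedPointAlgebra α, φ (R.π a) = R.π a}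

/-- `φ` is a minimal element of `𝔐` for the (pre)order
`ψ ≤ φ ↔ ‖ψ(x)‖ ≤ ‖φ(x)‖ for all x ∈ B(H)`. -/
def IsMinimalGMap (R : CovariantRep α H) (φ : (H →L[ℂ] H) →CP (H →L[ℂ] H)) : Prop :=
  φ ∈ R.gMaps ∧ ∀ ψ ∈ R.gMaps, (∀ x, ‖ψ x‖ ≤ ‖φ x‖) → ∀ x, ‖φ x‖ ≤ ‖ψ x‖

/-- The Furstenberg–Hamana boundary `𝓑_{π,u}` of `(π, u, H)`, realized as the image of a given
minimal element `φ` of `𝔐`. -/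
def boundary (R : CovariantRep α H) {φ : (H →L[ℂ] H) →CP (H →L[ℂ] H)}
    (_hφ : R.IsMinimalGMap φ) : Submodule ℂ (H →L[ℂ] H) :=
  LinearMap.range φ.toLinearMap

theorem Ad_mem_boundary (R : CovariantRep α H) {φ : (H →L[ℂ] H) →CP (H →L[ℂ] H)}
    (hφ : R.IsMinimalGMap φ) (t : G) {x : H →L[ℂ] H} (hx : x ∈ R.boundary hφ) :
    R.Ad t x ∈ R.boundary hφ := by
  obtain ⟨y, rfl⟩ := hx
  exact ⟨R.Ad t y, hφ.1.1.equivariant t y⟩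

/-- The action of `G` on the boundary `𝓑_{π,u}`: the restriction of the adjoint action of `G` on
`B(H)`. -/
def boundaryAction (R : CovariantRep α H) {φ : (H →L[ℂ] H) →CP (H →L[ℂ] H)}
    (hφ : R.IsMinimalGMap φ) : Representation ℂ G (R.boundary hφ) where
  toFun t :=
    { toFun := fun x => ⟨R.Ad t x, R.Ad_mem_boundary hφ t x.2⟩
      map_add' := fun x y => Subtype.ext (map_add (R.Ad t) _ _)
      map_smul' := fun c x => Subtype.ext (map_smul (R.Ad t) c _) }
  map_one' := by
    ext1 x
    exact Subtype.ext (by simp [map_one])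
  map_mul' s t := by
    ext1 x
    exact Subtype.ext (by simp [map_mul])

end CovariantRep

end

/-! Averaging `Ad` over the finite conjugacy class of `g` gives a map `ψ` in `𝔐`. Minimality forces
rigidity, `φ ∘ ψ ∘ φ = φ` (`apply_apply_apply`); since `φ` and `ψ` commute by equivariance, `ψ`
fixes the image of `φ`. So each `y` there is the mean of its conjugates `R.Ad k y`. Their variance,
the mean of `|R.Ad k y - y|²`, equals `ψ (y* y) - y* y`, which `φ` kills. Each summand is positive,
so `φ` kills each, and Kadison–Schwarz gives `φ (R.Ad g y - y) = 0`, that is, `R.Ad g y = y`. -/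

open scoped CStarAlgebra ComplexOrder

noncomputable section

namespace CompletelyPositiveMap

/-! ### Composition and averaging of completely positive maps -/

section General

variable {A B C : Type*} [NonUnitalCStarAlgebra A] [NonUnitalCStarAlgebra B]
  [NonUnitalCStarAlgebra C] [PartialOrder A] [PartialOrder B] [PartialOrder C]
  [StarOrderedRing A] [StarOrderedRing B] [StarOrderedRing C]

/-- The composition of completely positive maps. -/
def comp (f : B →CP C) (g : A →CP B) : A →CP C where
  toLinearMap := f.toLinearMap.comp g.toLinearMap
  map_cstarMatrix_nonneg' k M hM :=
    f.map_cstarMatrix_nonneg' k _ (g.map_cstarMatrix_nonneg' k M hM)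

@[simp]
theorem comp_apply (f : B →CP C) (g : A →CP B) (x : A) : f.comp g x = f (g x) := rfl

/-- The average of a finite family of completely positive maps. -/
def average {ι : Type*} (s : Finset ι) (f : ι → A →CP B) : A →CP B where
  toLinearMap := (s.card : ℂ)⁻¹ • ∑ i ∈ s, (f i).toLinearMap
  map_cstarMatrix_nonneg' k M hM := by
    have key : M.map ((s.card : ℂ)⁻¹ • ∑ i ∈ s, (f i).toLinearMap : A →ₗ[ℂ] B) =
        (s.card : ℂ)⁻¹ • ∑ i ∈ s, M.map (f i).toLinearMap := by
      have hsum : ∀ t : Finset ι, M.map (∑ i ∈ t, (f i).toLinearMap : A →ₗ[ℂ] B) =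
          ∑ i ∈ t, M.map (f i).toLinearMap := by
        classical
        intro t
        induction t using Finset.induction_on with
        | empty => ext; simp
        | insert a t ha ih =>
          rw [Finset.sum_insert ha, Finset.sum_insert ha, ← ih]
          ext
          simp
      rw [← hsum]
      ext
      simp
    rw [key]
    have hc : (0 : ℂ) ≤ (s.card : ℂ)⁻¹ := inv_nonneg.2 (Nat.cast_nonneg _)
    exact smul_nonneg hc (Finset.sum_nonneg fun i _ => (f i).map_cstarMatrix_nonneg' k M hM)

theorem average_apply {ι : Type*} (s : Finset ι) (f : ι → A →CP B) (x : A) :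
    average s f x = (s.card : ℂ)⁻¹ • ∑ i ∈ s, f i x := by
  change ((s.card : ℂ)⁻¹ • ∑ i ∈ s, (f i).toLinearMap : A →ₗ[ℂ] B) x = _
  rw [LinearMap.smul_apply, LinearMap.sum_apply]
  rfl

theorem average_apply_of_forall_eq {ι : Type*} {s : Finset ι} (hs : s.Nonempty)
    {f : ι → A →CP B} {x : A} {y : B} (h : ∀ i ∈ s, f i x = y) : average s f x = y := by
  have hc : (s.card : ℂ) ≠ 0 := by exact_mod_cast hs.card_pos.ne'
  rw [average_apply, Finset.sum_congr rfl h, Finset.sum_const, ← Nat.cast_smul_eq_nsmul ℂ,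
    smul_smul, inv_mul_cancel₀ hc, one_smul]

theorem map_nonneg' (f : A →CP B) {x : A} (hx : 0 ≤ x) : 0 ≤ f x := map_nonneg f hx

theorem map_star' (f : A →CP B) (x : A) : f (star x) = star (f x) := by
  have : ∀ y : A, IsSelfAdjoint y → IsSelfAdjoint (f y) := fun y hy => hy.map' f
  rw [← realPart_add_I_smul_imaginaryPart x]
  simp only [star_add, star_smul, map_add, map_smul, (this _ (realPart x).2).star_eq,
    (this _ (imaginaryPart x).2).star_eq, (realPart x).2.star_eq, (imaginaryPart x).2.star_eq]

end General

/-! ### Kadison–Schwarz and contractivity -/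

section Unital

variable {A B : Type*} [CStarAlgebra A] [CStarAlgebra B] [PartialOrder A] [PartialOrder B]
  [StarOrderedRing A] [StarOrderedRing B]

/-- Positive matrices are sums of `star N * N`, whose diagonal entries are sums of `star b * b`. -/
theorem _root_.CStarMatrix.nonneg_apply_self {n : Type*} [Fintype n] {M : CStarMatrix n n B}
    (hM : 0 ≤ M) (i : n) : 0 ≤ M i i := by
  rw [StarOrderedRing.nonneg_iff] at hM
  induction hM using AddSubmonoid.closure_induction with
  | mem M hM =>
    obtain ⟨N, rfl⟩ := hM
    exact Finset.sum_nonneg fun j _ => star_mul_self_nonneg (N j i)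
  | zero => exact le_rfl
  | add M N _ _ hM hN => exact add_nonneg hM hN

/-- The **Kadison–Schwarz inequality** for unital completely positive maps. -/
theorem star_mul_self_le (f : A →CP B) (hf : f 1 = 1) (x : A) :
    star (f x) * f x ≤ f (star x * x) := by
  -- `star N * N` is `[[1, x], [x*, x* x]]`; compressing its image by the column `(-f x, 1)` leaves
  -- the Schwarz defect in the corner.
  let N : CStarMatrix (Fin 2) (Fin 2) A := CStarMatrix.ofMatrix !![1, x; 0, 0]
  let D : CStarMatrix (Fin 2) (Fin 2) B := CStarMatrix.ofMatrix !![-f x, 0; 1, 0]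
  have h := CStarMatrix.nonneg_apply_self (star_left_conjugate_nonneg
    (f.map_cstarMatrix_nonneg (star N * N) (star_mul_self_nonneg N)) D) 0
  have h2 : (star D * (star N * N).map f * D) 0 0 = f (star x * x) - star (f x) * f x := by
    simp [CStarMatrix.mul_apply, CStarMatrix.star_apply, Fin.sum_univ_two, N, D,
      CStarMatrix.ofMatrix_apply, hf, map_star']
    abel
  rw [h2] at h
  exact sub_nonneg.1 h

theorem norm_apply_le (f : A →CP B) (hf : f 1 = 1) (x : A) : ‖f x‖ ≤ ‖x‖ := by
  have h1 : f (star x * x) ≤ algebraMap ℝ B (‖x‖ ^ 2) := by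
    have := OrderHomClass.mono f (CStarAlgebra.star_mul_le_algebraMap_norm_sq (a := x))
    refine this.trans_eq ?_
    rw [Algebra.algebraMap_eq_smul_one, Algebra.algebraMap_eq_smul_one,
      ← Complex.coe_smul, ← Complex.coe_smul, map_smul, hf]
  have h2 := CStarAlgebra.norm_le_norm_of_nonneg_of_le (star_mul_self_nonneg _)
    ((f.star_mul_self_le hf x).trans h1)
  rw [CStarRing.norm_star_mul_self] at h2
  have h3 : ‖algebraMap ℝ B (‖x‖ ^ 2)‖ ≤ ‖x‖ * ‖x‖ := by
    cases subsingleton_or_nontrivial B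
    · rw [Subsingleton.elim (algebraMap ℝ B (‖x‖ ^ 2)) 0, norm_zero]; positivity
    · rw [norm_algebraMap', Real.norm_of_nonneg (by positivity), sq]
  exact (mul_self_le_mul_self_iff (norm_nonneg _) (norm_nonneg _)).2 (h2.trans h3)

/-- A unital completely positive map annihilating `star x * x` annihilates `x`. -/
theorem apply_eq_zero_of_star_mul_self (f : A →CP B) (hf : f 1 = 1) {x : A}
    (hx : f (star x * x) = 0) : f x = 0 := by
  refine CStarRing.star_mul_self_eq_zero_iff _ |>.1 (le_antisymm ?_ (star_mul_self_nonneg _))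
  exact (f.star_mul_self_le hf x).trans_eq hx

end Unital

end CompletelyPositiveMap

/-! ### Minimal maps: rigidity and triviality of the action -/

namespace CovariantRep

variable {G A : Type*} [Group G] [NonUnitalCStarAlgebra A] {α : G →* (A ≃⋆ₐ[ℂ] A)}
  {H : Type*} [NormedAddCommGroup H] [InnerProductSpace ℂ H] [CompleteSpace H]
  {R : CovariantRep α H}

open CompletelyPositiveMap

theorem Ad_smul (t : G) (c : ℂ) (x : H →L[ℂ] H) : R.Ad t (c • x) = c • R.Ad t x := by
  rw [Ad_apply, Ad_apply, mul_smul_comm, smul_mul_assoc]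

theorem Ad_star (t : G) (x : H →L[ℂ] H) : R.Ad t (star x) = star (R.Ad t x) := by
  simp only [Ad_apply, star_mul, star_star, mul_assoc]

theorem comp_mem_gMaps {f g : (H →L[ℂ] H) →CP (H →L[ℂ] H)} (hf : f ∈ R.gMaps)
    (hg : g ∈ R.gMaps) : f.comp g ∈ R.gMaps := by
  refine ⟨⟨?_, fun t x => ?_⟩, fun a ha => ?_⟩
  · rw [comp_apply, hg.1.unital, hf.1.unital]
  · rw [comp_apply, comp_apply, hg.1.equivariant, hf.1.equivariant]
  · rw [comp_apply, hg.2 a ha, hf.2 a ha]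

theorem average_mem_gMaps {ι : Type*} {s : Finset ι} (hs : s.Nonempty)
    {f : ι → (H →L[ℂ] H) →CP (H →L[ℂ] H)} (hf : ∀ i ∈ s, f i ∈ R.gMaps) :
    average s f ∈ R.gMaps := by
  refine ⟨⟨?_, fun t x => ?_⟩, fun a ha => ?_⟩
  · exact average_apply_of_forall_eq hs fun i hi => (hf i hi).1.unital
  · rw [average_apply, average_apply, Ad_smul, map_sum (R.Ad t)]
    exact congrArg _ (Finset.sum_congr rfl fun i hi => (hf i hi).1.equivariant t x)
  · exact average_apply_of_forall_eq hs fun i hi => (hf i hi).2 a ha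

variable (R) in
/-- The adjoint action of a group element as a completely positive map. -/
def adCP (t : G) : (H →L[ℂ] H) →CP (H →L[ℂ] H) :=
  CompletelyPositiveMapClass.toCompletelyPositiveLinearMap (R.Ad t)

theorem adCP_apply (t : G) (x : H →L[ℂ] H) : R.adCP t x = R.Ad t x := rfl

theorem id_mem_gMaps : R.adCP 1 ∈ R.gMaps := by
  have h : ∀ x, R.adCP 1 x = x := fun x => by rw [adCP_apply, map_one]; rfl
  exact ⟨⟨h 1, fun t x => by rw [h, h]⟩, fun a _ => h _⟩

/-- Averaging the adjoint action over a finite conjugacy class gives an element of `𝔐`. -/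
theorem average_adCP_mem_gMaps {g : G} (hg : (conjugatesOf g).Finite) :
    average hg.toFinset R.adCP ∈ R.gMaps := by
  have hs : hg.toFinset.Nonempty := ⟨g, by simp [mem_conjugatesOf_self]⟩
  refine ⟨⟨?_, fun t x => ?_⟩, fun a ha => ?_⟩
  · exact average_apply_of_forall_eq hs fun k _ => map_one (R.Ad k)
  · rw [average_apply, average_apply, Ad_smul, map_sum (R.Ad t)]
    -- Reindex by `k ↦ t⁻¹ k t`, which preserves the class, using `k t = t (t⁻¹ k t)`.
    refine congrArg _ (Finset.sum_equiv (MulAut.conj t).toEquiv.symm (fun k => ?_) fun k _ => ?_)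
    · simp only [Set.Finite.mem_toFinset, conjugatesOf, Set.mem_ofPred_eq]
      have : IsConj k ((MulAut.conj t).toEquiv.symm k) :=
        isConj_iff.2 ⟨t⁻¹, by simp⟩
      exact ⟨fun h => h.trans this, fun h => h.trans this.symm⟩
    · rw [adCP_apply, adCP_apply, ← StarAlgEquiv.mul_apply, ← StarAlgEquiv.mul_apply, ← map_mul,
        ← map_mul]
      congr 2
      simp [mul_assoc]
  · refine average_apply_of_forall_eq hs fun k _ => ?_
    rw [adCP_apply, Ad_apply, R.covariant, ha k]

variable {φ : (H →L[ℂ] H) →CP (H →L[ℂ] H)}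

/-- Elements of `𝔐` are isometric on the image of a minimal element. -/
theorem IsMinimalGMap.norm_apply (hφ : R.IsMinimalGMap φ) {ψ : (H →L[ℂ] H) →CP (H →L[ℂ] H)}
    (hψ : ψ ∈ R.gMaps) (x : H →L[ℂ] H) : ‖ψ (φ x)‖ = ‖φ x‖ :=
  -- `ψ` is contractive, so `ψ ∘ φ` lies below `φ` in `𝔐`, and minimality reverses the inequality.
  le_antisymm (ψ.norm_apply_le hψ.1.unital _)
    (hφ.2 (ψ.comp φ) (comp_mem_gMaps hψ hφ.1) (fun _ => ψ.norm_apply_le hψ.1.unital _) x)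

/-- A minimal element of `𝔐` is rigid: `φ ∘ ψ` is the identity on its image for `ψ ∈ 𝔐`. -/
theorem IsMinimalGMap.apply_apply_apply (hφ : R.IsMinimalGMap φ)
    {ψ : (H →L[ℂ] H) →CP (H →L[ℂ] H)} (hψ : ψ ∈ R.gMaps) (x : H →L[ℂ] H) :
    φ (ψ (φ x)) = φ x := by
  -- `T n = (φ ∘ ψ)ⁿ`. Its Cesàro means are isometric on `φ z`, yet telescope there to norm at most
  -- `2‖φ x‖ / (n + 1)`.
  let T : ℕ → (H →L[ℂ] H) →CP (H →L[ℂ] H) := fun n =>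
    Nat.rec (R.adCP 1) (fun _ f => f.comp (φ.comp ψ)) n
  have hT : ∀ n, T n ∈ R.gMaps := fun n => by
    induction n with
    | zero => exact id_mem_gMaps
    | succ n ih => exact comp_mem_gMaps ih (comp_mem_gMaps hφ.1 hψ)
  set z := ψ (φ x) - x with hz
  have hzφ : φ z = φ (ψ (φ x)) - φ x := map_sub φ _ _
  have hTz : ∀ n, T n (φ z) = T (n + 1) (φ x) - T n (φ x) := fun n => by
    rw [hzφ, map_sub]; rfl
  have hbound : ∀ n : ℕ, ‖φ z‖ * (n + 1) ≤ 2 * ‖φ x‖ := fun n => by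
    have hs : (Finset.range (n + 1)).Nonempty := ⟨0, by simp⟩
    rw [← hφ.norm_apply (average_mem_gMaps hs fun i _ => hT i) z, average_apply,
      Finset.sum_congr rfl fun i _ => hTz i, Finset.sum_range_sub (fun i => T i (φ x)),
      norm_smul, Finset.card_range, norm_inv, Complex.norm_natCast]
    have h1 : ‖T (n + 1) (φ x) - T 0 (φ x)‖ ≤ 2 * ‖φ x‖ := by
      refine (norm_sub_le _ _).trans_eq ?_
      rw [hφ.norm_apply (hT (n + 1)), hφ.norm_apply (hT 0), two_mul]
    refine le_trans (le_of_eq ?_) h1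
    push_cast
    field_simp
  have h0 : ‖φ z‖ = 0 := by
    by_contra hne
    have hpos : 0 < ‖φ z‖ := lt_of_le_of_ne (norm_nonneg _) (Ne.symm hne)
    obtain ⟨n, hn⟩ := exists_nat_gt (2 * ‖φ x‖ / ‖φ z‖)
    rw [div_lt_iff₀ hpos] at hn
    nlinarith [hbound n]
  rw [norm_eq_zero, hzφ] at h0
  exact sub_eq_zero.1 h0

/-- Rigidity with `ψ` the identity, written as `R.adCP 1`. -/
theorem IsMinimalGMap.idempotent (hφ : R.IsMinimalGMap φ) (x : H →L[ℂ] H) :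
    φ (φ x) = φ x := by
  have h := hφ.apply_apply_apply id_mem_gMaps x
  rwa [adCP_apply, map_one] at h

/-- Elements with finite conjugacy class act trivially on the image of a minimal element. -/
theorem IsMinimalGMap.Ad_apply_eq (hφ : R.IsMinimalGMap φ) {g : G}
    (hg : (conjugatesOf g).Finite) (x : H →L[ℂ] H) : R.Ad g (φ x) = φ x := by
  set s := hg.toFinset
  have hgs : g ∈ s := by simp [s, mem_conjugatesOf_self]
  set ψ := average s R.adCP with hψdef
  have hψ : ψ ∈ R.gMaps := average_adCP_mem_gMaps hg
  have hc : (s.card : ℂ) ≠ 0 := by exact_mod_cast (Finset.card_pos.2 ⟨g, hgs⟩).ne'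
  have hsum : ∀ w, ∑ k ∈ s, R.Ad k w = (s.card : ℂ) • ψ w := fun w => by
    rw [hψdef, average_apply, smul_smul, mul_inv_cancel₀ hc, one_smul]; rfl
  have hcomm : ∀ w, φ (ψ w) = ψ (φ w) := fun w => by
    rw [hψdef, average_apply, average_apply, map_smul, map_sum]
    exact congrArg _ (Finset.sum_congr rfl fun k _ => hφ.1.1.equivariant k w)
  have hfix : ∀ w, ψ (φ w) = φ w := fun w => by
    rw [← hφ.idempotent w, ← hcomm, hφ.apply_apply_apply hψ, hφ.idempotent]
  set y := φ x
  have hvar : ∑ k ∈ s, φ (star (R.Ad k y - y) * (R.Ad k y - y)) = 0 := by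
    -- The variance identity: the cross terms collapse because `ψ y = y`.
    have h1 : ∑ k ∈ s, star (R.Ad k y - y) * (R.Ad k y - y) =
        (s.card : ℂ) • (ψ (star y * y) - star y * y) := by
      have h2 : ∀ k, star (R.Ad k y - y) * (R.Ad k y - y) =
          R.Ad k (star y * y) - star (R.Ad k y) * y - star y * R.Ad k y + star y * y := fun k => by
        rw [map_mul (R.Ad k), Ad_star, star_sub]; noncomm_ring
      simp only [h2, Finset.sum_add_distrib, Finset.sum_sub_distrib, ← Finset.sum_mul,
        ← Finset.mul_sum, ← star_sum, hsum, y, hfix, Finset.sum_const]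
      rw [← Nat.cast_smul_eq_nsmul ℂ, star_smul]
      simp only [star_natCast, smul_mul_assoc, mul_smul_comm, smul_sub]
      abel
    rw [← map_sum, h1, map_smul, map_sub, hcomm, hfix, sub_self, smul_zero]
  have hzero := (Finset.sum_eq_zero_iff_of_nonneg fun k _ =>
    φ.map_nonneg' (star_mul_self_nonneg (R.Ad k y - y))).1 hvar g hgs
  have h := φ.apply_eq_zero_of_star_mul_self hφ.1.1.unital hzero
  rw [map_sub, hφ.1.1.equivariant, hφ.idempotent] at h
  exact sub_eq_zero.1 h

end CovariantRep

end

theorem proposition3p6 {G A : Type*} [Group G] [NonUnitalCStarAlgebra A]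
    (α : G →* (A ≃⋆ₐ[ℂ] A))
    {H : Type*} [NormedAddCommGroup H] [InnerProductSpace ℂ H] [CompleteSpace H]
    (R : CovariantRep α H)
    {φ : (H →L[ℂ] H) →CP (H →L[ℂ] H)} (hφ : R.IsMinimalGMap φ)
    (g : G) (hg : (conjugatesOf g).Finite) (x : R.boundary hφ) :
    R.boundaryAction hφ g x = x := by
  obtain ⟨_, y, rfl⟩ := x
  exact Subtype.ext (hφ.Ad_apply_eq hg y)
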